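/- Fix $\alpha>1$, $s(0)<0$, $\dot r(0)>0$ and $\dot s(0)>0$. Let $\Delta=\alpha^2-1$, $\xi_1=-\alpha+\sqrt\Delta$, $\xi_2=-\alpha-\sqrt\Delta$, $t_0=-s(0)/\dot s(0)$ and $E=\dot r(0)^2\dot s(0)^2/(4\Delta)$. For $k>0$ let $\eta=e^{\xi_1t_0\sqrt k/2}$ and $\varepsilon=e^{(\xi_2-\xi_1)t_0\sqrt k}$, and let $R$ be the positive solution on $[0,\infty)$ of $$\ddot R-\frac{E(1-\varepsilon)^2}{R^3}+2\alpha\dot R+R=0,\qquad R(0)=\frac{\eta\,\dot r(0)(1-\varepsilon)}{2\sqrt\Delta},\qquad \dot R(0)=\frac{\eta\,\dot r(0)\,\xi_1(1-\varepsilon\xi_2/\xi_1)}{2\sqrt\Delta}.$$ Let $M=\begin{pmatrix}0&1\\-1&-2\alpha\end{pmatrix}$ and $Q=\int_0^\infty e^{sM^*}e^{sM}\,ds$, let $\lambda_1$ and $\lambda_2$ be the smallest and the largest eigenvalue of $Q$, write $x=(R,\dot R)^T$, and let $F(x)=x_1^2+E(1-\varepsilon)^2/x_1^2+x_2^2$.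 Fix any number $$\bar R>\max\left(\left(\frac{4E\lambda_2^{3/2}}{\lambda_1^{1/2}}\right)^{1/4},\ E^{1/4}\right)$$ and put $\bar F=\bar R^2+E(1-\varepsilon)^2\bar R^{-2}+\xi_1^2\bar R^2$. Theorem. There exist strictly positive numbers $R_m$, $R_M$, $V_M$, independent of $k$, such that for every $\zeta\in(0,1/|\xi_1|)$ there exist $C>0$ and $k_0>0$ for which the following holds for all $k\ge k_0$, with $\tau_3=\zeta\ln(1/\eta)$. The solution $R$ exists on $[0,\infty)$; there is a smallest time $\tau_4\in[\tau_3,\infty)$ such that $R(\tau_4)=\bar R$; this time satisfies $$\tau_4\le\tau_3+2\lambda_2\bigl[\ln\bigl(x^*Qx\bigr)(\tau_3)-\ln\bigl(\lambda_1\bar R^2\bigr)\bigr],\qquad \tau_4\le\tau_3+C\ln(1/\eta),$$ $$\xi_1\bar R\le\dot R(\tau_4)\le0,\qquad F(x(\tau_4))\le\bar F;$$ and for all $\tau\ge\tau_4$, $$R_m\le R(\tau)\le R_M,\qquad |\dot R(\tau)|\le V_M,$$ $$\frac{E(1-\varepsilon)}{\bar F}\le R(\tau)^2\le\bar F,\qquad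 \dot R(\tau)^2\le\bar F.$$ -/

import Mathlib

open Set

noncomputable section

namespace CornerPenalty

/-- The data of the problem that do not depend on the stiffness `k`: the damping parameter
`α > 1` and the initial data at the first impact, where `r` is the coordinate normal to the
first side of the wedge (with `r(0) = 0`) and `s` is the coordinate along it, measured
from the corner. -/
structure Data where
  /-- damping parameter `α` -/
  α : ℝ
  /-- initial position `s(0)` along the side -/
  s₀ : ℝ
  /-- initial normal velocity -/
  dr₀ : ℝ
  /-- initial tangential velocity -/
  ds₀ : ℝ
  one_lt_α : 1 < α
  s₀_neg : s₀ < 0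
  dr₀_pos : 0 < dr₀
  ds₀_pos : 0 < ds₀

namespace Data

variable (d : Data)

/-- `Δ = α² - 1`. -/
def Δ : ℝ := d.α ^ 2 - 1

/-- The larger root `ξ₁` of `ξ² + 2αξ + 1 = 0`. -/
def ξ₁ : ℝ := -d.α + Real.sqrt d.Δ

/-- The smaller root `ξ₂` of `ξ² + 2αξ + 1 = 0`. -/
def ξ₂ : ℝ := -d.α - Real.sqrt d.Δ

/-- The time `t₀` at which the free tangential motion reaches the corner. -/
def t₀ : ℝ := -d.s₀ / d.ds₀

/-- The constant `E = ṙ(0)² ṡ(0)² / (4Δ)`. -/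
def E : ℝ := d.dr₀ ^ 2 * d.ds₀ ^ 2 / (4 * d.Δ)

/-- The small scale `η = exp(ξ₁ t₀ √k / 2)`. -/
def η (k : ℝ) : ℝ := Real.exp (d.ξ₁ * d.t₀ * Real.sqrt k / 2)

/-- The small number `ε = exp((ξ₂ - ξ₁) t₀ √k)`. -/
def ε (k : ℝ) : ℝ := Real.exp ((d.ξ₂ - d.ξ₁) * d.t₀ * Real.sqrt k)

/-- The initial value `R(0)` of the scaled radius. -/
def initR (k : ℝ) : ℝ := d.η k * d.dr₀ * (1 - d.ε k) / (2 * Real.sqrt d.Δ)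

/-- The initial value `Ṙ(0)` of the scaled radial velocity. -/
def initV (k : ℝ) : ℝ :=
  d.η k * d.dr₀ * d.ξ₁ * (1 - d.ε k * d.ξ₂ / d.ξ₁) / (2 * Real.sqrt d.Δ)

/-- `R` is a positive solution on `[0, ∞)`, with velocity `V = Ṙ`, of
`R̈ - E (1 - ε)² / R³ + 2 α Ṙ + R = 0` with the initial data `initR`, `initV`
(derivatives are one-sided at `τ = 0`). -/
structure IsScaledMotion (k : ℝ) (R V : ℝ → ℝ) : Prop where
  pos : ∀ τ, 0 ≤ τ → 0 < R τ
  init_R : R 0 = d.initR k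
  init_V : V 0 = d.initV k
  deriv_R : ∀ τ, 0 ≤ τ → HasDerivWithinAt R (V τ) (Ici 0) τ
  deriv_V : ∀ τ, 0 ≤ τ →
    HasDerivWithinAt V (d.E * (1 - d.ε k) ^ 2 / R τ ^ 3 - 2 * d.α * V τ - R τ) (Ici 0) τ

/-- The time `τ₃ = ζ ln(1/η)`. -/
def τ₃ (ζ k : ℝ) : ℝ := ζ * Real.log (1 / d.η k)

/-- The matrix of the linear part of the first order system for `x = (R, Ṙ)`. -/
def M : Matrix (Fin 2) (Fin 2) ℝ := !![0, 1; -1, -2 * d.α]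

/-- `Q = ∫₀^∞ exp(s Mᵀ) exp(s M) ds`, the integral being taken entry by entry. -/
def Q : Matrix (Fin 2) (Fin 2) ℝ :=
  Matrix.of fun i j => ∫ s in Ioi (0 : ℝ),
    (NormedSpace.exp (s • d.M.transpose) * NormedSpace.exp (s • d.M)) i j

/-- The quadratic form `x* Q x` at `x = (R, V)`. -/
def quadForm (R V : ℝ) : ℝ := dotProduct ![R, V] (d.Q.mulVec ![R, V])

/-- The smallest eigenvalue of `Q`. -/
def lam₁ : ℝ := sInf (spectrum ℝ d.Q)

/-- The largest eigenvalue of `Q`. -/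
def lam₂ : ℝ := sSup (spectrum ℝ d.Q)

/-- The energy functional `F(x) = x₁² + E (1 - ε)² / x₁² + x₂²`. -/
def F (k R V : ℝ) : ℝ := R ^ 2 + d.E * (1 - d.ε k) ^ 2 / R ^ 2 + V ^ 2

/-- The energy level `F̄ = R̄² + E (1 - ε)² R̄⁻² + ξ₁² R̄²`. -/
def Fbar (k Rbar : ℝ) : ℝ :=
  Rbar ^ 2 + d.E * (1 - d.ε k) ^ 2 / Rbar ^ 2 + d.ξ₁ ^ 2 * Rbar ^ 2

/-- The threshold that `R̄` has to exceed. -/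
def threshold : ℝ :=
  max ((4 * d.E * d.lam₂ ^ (3 / 2 : ℝ) / d.lam₁ ^ (1 / 2 : ℝ)) ^ (1 / 4 : ℝ))
    (d.E ^ (1 / 4 : ℝ))

end Data

end CornerPenalty

end

noncomputable section

namespace CornerPenalty

namespace Data

variable (d : Data)

/-! The linear operator factors as (d/dt - ξ₂)(d/dt - ξ₁), so w = Ṙ - ξ₁R obeys ẇ - ξ₂w = E(1 -
ε)²/R³ ≥ 0. As w(0) > 0, both exp(-ξ₂t)w and exp(-ξ₁t)R are nondecreasing and w stays positive. This
excludes collapse onto the singularity, hence gives global existence, and it gives Ṙ ≥ ξ₁R for all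
time (`sub_pos`).

Since R(0) is of order η, the repulsion produces w of order 1/η almost at once
(`exists_div_le_sub`). Monotonicity then gives R(t) ≥ const · exp(ξ₁t)/η for t ≥ 2, which at τ₃ is
const · (1/η)^(1 + ξ₁ζ). The exponent is positive because ζ < 1/|ξ₁|, so R(τ₃) > R̄ for large k.

While R ≥ R̄, the threshold lets the force spoil at most half of the Lyapunov decay of x*Qx, which
therefore decreases at rate 1/(2λ₂) but stays above λ₁R̄². So R must come down to R̄ in a time
logarithmic in (x*Qx)(τ₃) (`exists_first_hitting`). Since F is nonincreasing and F(x(0)) = O(η⁻²),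
that time is O(ln(1/η)).

At the first hit ξ₁R̄ ≤ Ṙ ≤ 0, so F ≤ F̄ there, and dissipation of F confines the motion from then
on. The estimates hold for every solution, so uniqueness of R is not needed. -/

/-! ### Characteristic roots, closed form of Q and its eigenvalues. -/

lemma Δ_pos : 0 < d.Δ := by
  have := d.one_lt_α
  unfold Δ; nlinarith

lemma sqrt_Δ_pos : 0 < Real.sqrt d.Δ := Real.sqrt_pos.2 d.Δ_pos

lemma sq_sqrt_Δ : Real.sqrt d.Δ ^ 2 = d.α ^ 2 - 1 := Real.sq_sqrt d.Δ_pos.le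

lemma ξ_add : d.ξ₁ + d.ξ₂ = -2 * d.α := by unfold ξ₁ ξ₂; ring

lemma ξ_mul : d.ξ₁ * d.ξ₂ = 1 := by
  have := d.sq_sqrt_Δ
  unfold ξ₁ ξ₂; linarith

lemma ξ_sub : d.ξ₁ - d.ξ₂ = 2 * Real.sqrt d.Δ := by unfold ξ₁ ξ₂; ring

lemma ξ₂_neg : d.ξ₂ < 0 := by
  have := d.one_lt_α
  have := d.sqrt_Δ_pos
  unfold ξ₂; linarith

lemma ξ₁_neg : d.ξ₁ < 0 := by
  have := d.ξ₂_neg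
  have := d.ξ_mul
  nlinarith

lemma ξ₂_lt_ξ₁ : d.ξ₂ < d.ξ₁ := by
  have := d.sqrt_Δ_pos
  have := d.ξ_sub
  linarith

/-- The vectors (1, ξ₁) and (1, ξ₂) are eigenvectors of the companion matrix M, so conjugating by
them reduces the exponential to a diagonal one. -/
lemma exp_smul_M (s : ℝ) : NormedSpace.exp (s • d.M) =
    (d.ξ₁ - d.ξ₂)⁻¹ •
      !![-d.ξ₂ * Real.exp (s * d.ξ₁) + d.ξ₁ * Real.exp (s * d.ξ₂),
          Real.exp (s * d.ξ₁) - Real.exp (s * d.ξ₂);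
         -(Real.exp (s * d.ξ₁) - Real.exp (s * d.ξ₂)),
          d.ξ₁ * Real.exp (s * d.ξ₁) - d.ξ₂ * Real.exp (s * d.ξ₂)] := by
  have h0 : d.ξ₁ - d.ξ₂ ≠ 0 := (sub_pos.2 d.ξ₂_lt_ξ₁).ne'
  have hm := d.ξ_mul
  have ha := d.ξ_add
  set U : Matrix (Fin 2) (Fin 2) ℝ := !![1, 1; d.ξ₁, d.ξ₂] with hU
  have hdet : U.det = -(d.ξ₁ - d.ξ₂) := by rw [hU, Matrix.det_fin_two_of]; ring
  have hinv : U⁻¹ = (d.ξ₁ - d.ξ₂)⁻¹ • !![-d.ξ₂, 1; d.ξ₁, -1] := by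
    rw [Matrix.inv_def, hdet, hU, Matrix.adjugate_fin_two_of, Ring.inverse_eq_inv', inv_neg]
    ext i j
    fin_cases i <;> fin_cases j <;> simp
  have hunit : IsUnit U := by
    rw [Matrix.isUnit_iff_isUnit_det, hdet]; exact (neg_ne_zero.2 h0).isUnit
  have hM : s • d.M = U * Matrix.diagonal ![s * d.ξ₁, s * d.ξ₂] * U⁻¹ := by
    have hUM : U * Matrix.diagonal ![s * d.ξ₁, s * d.ξ₂] = s • d.M * U := by
      ext i j
      rw [Matrix.mul_diagonal]
      fin_cases i <;> fin_cases j <;> simp [hU, M]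
      · linear_combination s * d.ξ₁ * ha - s * hm
      · linear_combination s * d.ξ₂ * ha - s * hm
    rw [hUM, Matrix.mul_assoc, Matrix.mul_nonsing_inv _ (by
      rw [hdet]; exact (neg_ne_zero.2 h0).isUnit), Matrix.mul_one]
  rw [hM, Matrix.exp_conj _ _ hunit, Matrix.exp_diagonal, hinv]
  have he : NormedSpace.exp ![s * d.ξ₁, s * d.ξ₂]
      = ![Real.exp (s * d.ξ₁), Real.exp (s * d.ξ₂)] := by
    rw [Pi.exp_def]
    ext i
    fin_cases i <;> simp [Real.exp_eq_exp_ℝ]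
  rw [he, Matrix.mul_smul]
  congr 1
  ext i j
  rw [Matrix.mul_apply]
  simp only [Fin.sum_univ_two, Matrix.mul_diagonal]
  fin_cases i <;> fin_cases j <;> simp [hU]
  · ring
  · ring
  · linear_combination (Real.exp (s * d.ξ₂) - Real.exp (s * d.ξ₁)) * hm
  · ring

lemma integral_exp_comb (A B C : ℝ) :
    ∫ s in Ioi (0 : ℝ), (A * Real.exp (2 * d.ξ₁ * s) + B * Real.exp ((d.ξ₁ + d.ξ₂) * s)
      + C * Real.exp (2 * d.ξ₂ * s))
      = -(A / (2 * d.ξ₁) + B / (d.ξ₁ + d.ξ₂) + C / (2 * d.ξ₂)) := by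
  have h1 := d.ξ₁_neg
  have h2 := d.ξ₂_neg
  have i1 := integrableOn_exp_mul_Ioi (show 2 * d.ξ₁ < 0 by linarith) 0
  have i2 := integrableOn_exp_mul_Ioi (show d.ξ₁ + d.ξ₂ < 0 by linarith) 0
  have i3 := integrableOn_exp_mul_Ioi (show 2 * d.ξ₂ < 0 by linarith) 0
  rw [MeasureTheory.integral_add (MeasureTheory.Integrable.fun_add (i1.const_mul A) (i2.const_mul B)) (i3.const_mul C),
    MeasureTheory.integral_add (i1.const_mul A) (i2.const_mul B),
    MeasureTheory.integral_const_mul, MeasureTheory.integral_const_mul,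
    MeasureTheory.integral_const_mul,
    integral_exp_mul_Ioi (by linarith), integral_exp_mul_Ioi (by linarith),
    integral_exp_mul_Ioi (by linarith)]
  simp
  ring

/-- The closed form of the solution `Q` of the Lyapunov equation `Mᵀ Q + Q M = -1`. -/
lemma Q_eq : d.Q = !![d.α + 1 / (2 * d.α), 1 / 2; 1 / 2, 1 / (2 * d.α)] := by
  have h1 := d.ξ₁_neg.ne
  have h2 := d.ξ₂_neg.ne
  have h0 : d.ξ₁ - d.ξ₂ ≠ 0 := (sub_pos.2 d.ξ₂_lt_ξ₁).ne'
  have hm := d.ξ_mul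
  have hα : d.α = -(d.ξ₁ + d.ξ₂) / 2 := by rw [d.ξ_add]; ring
  -- Every entry of the integrand is a combination of exp(2ξ₁s), exp((ξ₁+ξ₂)s) and exp(2ξ₂s).
  have key : ∀ (g : ℝ → ℝ) (A B C c : ℝ),
      (∀ s, g s = A * Real.exp (s * d.ξ₁) ^ 2 + B * (Real.exp (s * d.ξ₁) * Real.exp (s * d.ξ₂))
        + C * Real.exp (s * d.ξ₂) ^ 2) →
      -(A / (2 * d.ξ₁) + B / (d.ξ₁ + d.ξ₂) + C / (2 * d.ξ₂)) = c →
      ∫ s in Ioi (0 : ℝ), g s = c := by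
    intro g A B C c hg hc
    rw [← hc, ← d.integral_exp_comb]
    congr 1
    ext s
    rw [hg s, ← Real.exp_add, ← Real.exp_nat_mul, ← Real.exp_nat_mul]
    push_cast
    ring_nf
  have hy : d.ξ₂ = 1 / d.ξ₁ := by field_simp; linarith
  unfold Q
  simp only [← Matrix.transpose_smul, Matrix.exp_transpose, d.exp_smul_M]
  ext i j
  have hx2 : d.ξ₁ ^ 2 - 1 ≠ 0 := by
    intro h; apply h0; rw [hy]; field_simp; linarith
  fin_cases i <;> fin_cases j <;>
    simp [Matrix.mul_apply, Fin.sum_univ_two]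
  · refine key _ ((d.ξ₁ - d.ξ₂)⁻¹ ^ 2 * (d.ξ₂ ^ 2 + 1))
      ((d.ξ₁ - d.ξ₂)⁻¹ ^ 2 * (-4)) ((d.ξ₁ - d.ξ₂)⁻¹ ^ 2 * (d.ξ₁ ^ 2 + 1)) _ (fun s => ?_) ?_
    · linear_combination -2 * (d.ξ₁ - d.ξ₂)⁻¹ ^ 2 * Real.exp (s * d.ξ₁) * Real.exp (s * d.ξ₂) * hm
    · rw [hα, hy]
      field_simp
      ring
  · refine key _ ((d.ξ₁ - d.ξ₂)⁻¹ ^ 2 * (-(d.ξ₁ + d.ξ₂)))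
      ((d.ξ₁ - d.ξ₂)⁻¹ ^ 2 * (2 * (d.ξ₁ + d.ξ₂))) ((d.ξ₁ - d.ξ₂)⁻¹ ^ 2 * (-(d.ξ₁ + d.ξ₂))) _
      (fun s => ?_) ?_
    · ring
    · rw [hy]
      field_simp
      ring
  · refine key _ ((d.ξ₁ - d.ξ₂)⁻¹ ^ 2 * (-(d.ξ₁ + d.ξ₂)))
      ((d.ξ₁ - d.ξ₂)⁻¹ ^ 2 * (2 * (d.ξ₁ + d.ξ₂))) ((d.ξ₁ - d.ξ₂)⁻¹ ^ 2 * (-(d.ξ₁ + d.ξ₂))) _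
      (fun s => ?_) ?_
    · ring
    · rw [hy]
      field_simp
      ring
  · refine key _ ((d.ξ₁ - d.ξ₂)⁻¹ ^ 2 * (d.ξ₁ ^ 2 + 1))
      ((d.ξ₁ - d.ξ₂)⁻¹ ^ 2 * (-4)) ((d.ξ₁ - d.ξ₂)⁻¹ ^ 2 * (d.ξ₂ ^ 2 + 1)) _ (fun s => ?_) ?_
    · linear_combination -2 * (d.ξ₁ - d.ξ₂)⁻¹ ^ 2 * Real.exp (s * d.ξ₁) * Real.exp (s * d.ξ₂) * hm
    · rw [hα, hy]
      field_simp
      ring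

lemma quadForm_eq (R V : ℝ) :
    d.quadForm R V = (d.α + 1 / (2 * d.α)) * R ^ 2 + R * V + 1 / (2 * d.α) * V ^ 2 := by
  simp [quadForm, d.Q_eq, Matrix.mulVec, dotProduct, Fin.sum_univ_two]
  ring

/-- The spectrum of `Q` consists of the two roots of its characteristic polynomial. -/
lemma exists_spectrum_Q : ∃ l₁ l₂ : ℝ, spectrum ℝ d.Q = {l₁, l₂} ∧ l₁ ≤ l₂ ∧
    l₁ + l₂ = d.α + 1 / (2 * d.α) + 1 / (2 * d.α) ∧
    l₁ * l₂ = (d.α + 1 / (2 * d.α)) * (1 / (2 * d.α)) - 1 / 4 := by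
  have hQ := d.Q_eq
  set a := d.α + 1 / (2 * d.α)
  set c := 1 / (2 * d.α)
  clear_value a c
  have hr := Real.sq_sqrt (show 0 ≤ (a - c) ^ 2 + 1 by positivity)
  set r := Real.sqrt ((a - c) ^ 2 + 1)
  have hr0 : 0 ≤ r := Real.sqrt_nonneg _
  refine ⟨(a + c - r) / 2, (a + c + r) / 2, ?_, by linarith, by ring, by linarith⟩
  ext μ
  rw [spectrum.mem_iff, Matrix.isUnit_iff_isUnit_det, isUnit_iff_ne_zero, not_not, hQ,
    Matrix.det_fin_two]
  have : ((μ - a) * (μ - c) - 1 / 4 : ℝ) = (μ - (a + c - r) / 2) * (μ - (a + c + r) / 2) := by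
    linarith
  simp only [Matrix.sub_apply, Matrix.algebraMap_matrix_apply]
  simp
  rw [show (μ - a) * (μ - c) - 2⁻¹ * 2⁻¹ = (μ - a) * (μ - c) - 1 / 4 by ring, this, mul_eq_zero,
    sub_eq_zero, sub_eq_zero]

lemma lam_spec : d.lam₁ ≤ d.lam₂ ∧
    d.lam₁ + d.lam₂ = d.α + 1 / (2 * d.α) + 1 / (2 * d.α) ∧
    d.lam₁ * d.lam₂ = (d.α + 1 / (2 * d.α)) * (1 / (2 * d.α)) - 1 / 4 := by
  obtain ⟨l₁, l₂, hs, hle, h⟩ := d.exists_spectrum_Q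
  have h1 : d.lam₁ = l₁ := by rw [lam₁, hs, csInf_pair, inf_eq_left.2 hle]
  have h2 : d.lam₂ = l₂ := by rw [lam₂, hs, csSup_pair, sup_eq_right.2 hle]
  rw [h1, h2]
  exact ⟨hle, h⟩

lemma lam₁_pos : 0 < d.lam₁ := by
  obtain ⟨h, hs, hp⟩ := d.lam_spec
  have hα : 0 < d.α := by linarith [d.one_lt_α]
  have hc : 0 < 1 / (2 * d.α) := by positivity
  have h1 : d.α * (1 / (2 * d.α)) = 1 / 2 := by field_simp
  have h2 : 0 < d.lam₁ * d.lam₂ := by rw [hp]; nlinarith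
  by_contra hn
  nlinarith

lemma lam₂_pos : 0 < d.lam₂ := d.lam₁_pos.trans_le d.lam_spec.1

lemma lam₁_lt : d.lam₁ < d.α + 1 / (2 * d.α) := by
  obtain ⟨h, hs, hp⟩ := d.lam_spec
  have hα : 0 < d.α := by linarith [d.one_lt_α]
  by_contra hn
  linarith

/-- The characteristic polynomial equals -1/4 at the first diagonal entry, which therefore lies
strictly between the eigenvalues. Strictness is what allows division in the two bounds on the
quadratic form. -/
lemma lt_lam₂ : d.α + 1 / (2 * d.α) < d.lam₂ := by
  obtain ⟨h, hs, hp⟩ := d.lam_spec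
  by_contra hn
  have := mul_nonneg (sub_nonneg.2 (not_lt.1 hn)) (sub_nonneg.2 d.lam₁_lt.le)
  set a := d.α + 1 / (2 * d.α)
  have : (a - d.lam₂) * (a - d.lam₁) = -1 / 4 := by linear_combination hp - a * hs
  linarith

/-- The characteristic equation (a - λ₁)(c - λ₁) = 1/4 makes a - λ₁ times the difference of the two
sides a perfect square. -/
lemma lam₁_mul_le_quadForm (R V : ℝ) : d.lam₁ * (R ^ 2 + V ^ 2) ≤ d.quadForm R V := by
  obtain ⟨h, hs, hp⟩ := d.lam_spec
  have ha := d.lam₁_lt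
  rw [quadForm_eq]
  set a := d.α + 1 / (2 * d.α)
  set c := 1 / (2 * d.α)
  have hd : (a - d.lam₁) * (c - d.lam₁) = 1 / 4 := by
    linear_combination d.lam₁ * hs - hp
  have : 0 ≤ (a - d.lam₁) * (a * R ^ 2 + R * V + c * V ^ 2 - d.lam₁ * (R ^ 2 + V ^ 2)) := by
    have : (a - d.lam₁) * (a * R ^ 2 + R * V + c * V ^ 2 - d.lam₁ * (R ^ 2 + V ^ 2))
      = ((a - d.lam₁) * R + V / 2) ^ 2 := by linear_combination V ^ 2 * hd
    rw [this]; positivity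
  linarith [nonneg_of_mul_nonneg_right this (sub_pos.2 ha)]

lemma quadForm_le_lam₂_mul (R V : ℝ) : d.quadForm R V ≤ d.lam₂ * (R ^ 2 + V ^ 2) := by
  obtain ⟨h, hs, hp⟩ := d.lam_spec
  have ha := d.lt_lam₂
  rw [quadForm_eq]
  set a := d.α + 1 / (2 * d.α)
  set c := 1 / (2 * d.α)
  have hd : (d.lam₂ - a) * (d.lam₂ - c) = 1 / 4 := by
    linear_combination d.lam₂ * hs - hp
  have : 0 ≤ (d.lam₂ - a) * (d.lam₂ * (R ^ 2 + V ^ 2) - (a * R ^ 2 + R * V + c * V ^ 2)) := by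
    have : (d.lam₂ - a) * (d.lam₂ * (R ^ 2 + V ^ 2) - (a * R ^ 2 + R * V + c * V ^ 2))
      = ((d.lam₂ - a) * R - V / 2) ^ 2 := by linear_combination V ^ 2 * hd
    rw [this]; positivity
  linarith [nonneg_of_mul_nonneg_right this (sub_pos.2 ha)]

end Data
-- Monotonicity and global solvability of triangular systems.
lemma le_of_hasDerivWithinAt_nonneg {f f' : ℝ → ℝ} {a b : ℝ} (ha : 0 ≤ a) (hab : a ≤ b)
    (hd : ∀ t, 0 ≤ t → HasDerivWithinAt f (f' t) (Ici 0) t) (hn : ∀ t ∈ Icc a b, 0 ≤ f' t) :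
    f a ≤ f b := by
  have hsub : Icc a b ⊆ Ici 0 := fun t ht => ha.trans ht.1
  have hint : ∀ t ∈ interior (Icc a b), HasDerivAt f (f' t) t := fun t ht => by
    rw [interior_Icc] at ht
    exact (hd t (ha.trans ht.1.le)).hasDerivAt (Ici_mem_nhds (ha.trans_lt ht.1))
  refine monotoneOn_of_deriv_nonneg (convex_Icc a b)
    (fun t ht => (hd t (hsub ht)).continuousWithinAt.mono hsub)
    (fun t ht => (hint t ht).differentiableAt.differentiableWithinAt)
    (fun t ht => ?_) (left_mem_Icc.2 hab) (right_mem_Icc.2 hab) hab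
  rw [(hint t ht).deriv]
  exact hn t (interior_subset ht)

lemma hasDerivWithinAt_exp_mul (c t : ℝ) :
    HasDerivWithinAt (fun t => Real.exp (c * t)) (Real.exp (c * t) * c) (Ici 0) t := by
  simpa using (((hasDerivAt_id t).const_mul c).exp).hasDerivWithinAt

/-- Solutions on all intervals `[0, n]` of an equation with a Lipschitz right hand side
glue to a solution on `[0, ∞)`. -/
lemma exists_solution_Ici_of_forall_Icc {E : Type*} [NormedAddCommGroup E] [NormedSpace ℝ E]
    (v : ℝ → E → E) (x₀ : E)
    (hL : ∀ n : ℕ, ∃ K, ∀ t ∈ Icc (0 : ℝ) n, LipschitzWith K (v t))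
    (hex : ∀ n : ℕ, ∃ f : ℝ → E, f 0 = x₀ ∧
      ∀ t ∈ Icc (0 : ℝ) n, HasDerivWithinAt f (v t (f t)) (Icc 0 n) t) :
    ∃ f : ℝ → E, f 0 = x₀ ∧ ∀ t, 0 ≤ t → HasDerivWithinAt f (v t (f t)) (Ici 0) t := by
  choose g hg0 hg using hex
  have hr : ∀ (n : ℕ) (t : ℝ), t ∈ Ico (0 : ℝ) n →
      HasDerivWithinAt (g n) (v t (g n t)) (Ici 0) t := fun n t ht =>
    (hg n t ⟨ht.1, ht.2.le⟩).mono_of_mem_nhdsWithin <| by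
      rw [← Ici_inter_Iic, inter_comm]
      exact Filter.inter_mem (mem_nhdsWithin_of_mem_nhds (Iic_mem_nhds ht.2)) self_mem_nhdsWithin
  have huniq : ∀ m n : ℕ, m ≤ n → EqOn (g m) (g n) (Icc 0 m) := fun m n hmn => by
    have hmn' : (m : ℝ) ≤ n := Nat.cast_le.2 hmn
    obtain ⟨K, hK⟩ := hL m
    refine ODE_solution_unique_of_mem_Icc_right (s := fun _ => univ)
      (fun t ht => (hK t ⟨ht.1, ht.2.le⟩).lipschitzOnWith)
      (fun t ht => (hg m t ht).continuousWithinAt)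
      (fun t ht => (hr m t ht).mono (Ici_subset_Ici.2 ht.1)) (fun _ _ => trivial)
      (fun t ht => ((hg n t ⟨ht.1, ht.2.trans hmn'⟩).continuousWithinAt.mono
        (Icc_subset_Icc_right hmn')))
      (fun t ht => (hr n t ⟨ht.1, ht.2.trans_le hmn'⟩).mono (Ici_subset_Ici.2 ht.1))
      (fun _ _ => trivial) ((hg0 m).trans (hg0 n).symm)
  -- The index exceeds t strictly, so the derivative along [0, n] at t is also one along [0, ∞).
  refine ⟨fun t => g (⌊t⌋₊ + 1) t, hg0 _, fun t ht => ?_⟩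
  have hlt : t < (⌊t⌋₊ + 1 : ℕ) := by push_cast; exact Nat.lt_floor_add_one t
  refine (hr _ t ⟨ht, hlt⟩).congr_of_eventuallyEq ?_ rfl
  filter_upwards [self_mem_nhdsWithin, mem_nhdsWithin_of_mem_nhds (Iio_mem_nhds hlt)] with s hs hs'
  have hs0 : (0 : ℝ) ≤ s := hs
  refine huniq _ _ ?_ ⟨hs0, by push_cast; exact (Nat.lt_floor_add_one s).le⟩
  exact Nat.succ_le_of_lt ((Nat.floor_lt hs0).2 hs')

lemma lipschitzWith_triangular {φ : ℝ → ℝ} {Kφ : NNReal} (hφ : LipschitzWith Kφ φ)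
    {p q A B N : ℝ} (hp : |p| ≤ A) (hq : |q| ≤ B) (hN : 0 ≤ N) :
    LipschitzWith (A + B * Kφ * N).toNNReal
      (fun x : ℝ × ℝ => (p * x.2, q * φ (N * x.1))) := by
  have hA := (abs_nonneg p).trans hp
  have hB := (abs_nonneg q).trans hq
  refine LipschitzWith.of_dist_le_mul fun x y => ?_
  rw [Real.coe_toNNReal _ (by positivity), Prod.dist_eq]
  have h1 : dist x.1 y.1 ≤ dist x y := le_max_left _ _
  have h2 : dist x.2 y.2 ≤ dist x y := le_max_right _ _
  have h0 : 0 ≤ dist x y := dist_nonneg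
  refine max_le ?_ ?_
  · rw [Real.dist_eq] at h2 ⊢
    rw [← mul_sub, abs_mul]
    calc |p| * |x.2 - y.2| ≤ A * dist x y := by gcongr
      _ ≤ (A + B * Kφ * N) * dist x y := by
        gcongr; exact le_add_of_nonneg_right (by positivity)
  · have h3 := hφ.dist_le_mul (N * x.1) (N * y.1)
    rw [Real.dist_eq, Real.dist_eq, ← mul_sub, abs_mul, abs_of_nonneg hN, ← Real.dist_eq x.1] at h3
    rw [Real.dist_eq, ← mul_sub, abs_mul]
    calc |q| * |φ (N * x.1) - φ (N * y.1)| ≤ B * (Kφ * (N * dist x y)) := by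
          refine mul_le_mul hq (h3.trans ?_) (abs_nonneg _) hB
          gcongr
      _ = B * Kφ * N * dist x y := by ring
      _ ≤ (A + B * Kφ * N) * dist x y := by
        gcongr; exact le_add_of_nonneg_left hA

/-- Picard–Lindelöf requires speed times T to be at most the radius of the ball. The speed of z is
at most BP; on a ball of radius LT the speed of u is at most A(|z₀| + LT), and replacing u by u/N
brings it below 1 ≤ L. -/
lemma exists_solution_triangular_Icc {φ : ℝ → ℝ} {Kφ : NNReal} (hφ : LipschitzWith Kφ φ)
    {P : ℝ} (hP : ∀ x, |φ x| ≤ P) {a b : ℝ → ℝ} (ha : Continuous a) (hb : Continuous b)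
    {A B T : ℝ} (hT : 0 ≤ T) (hA : ∀ t ∈ Icc 0 T, |a t| ≤ A) (hB : ∀ t ∈ Icc 0 T, |b t| ≤ B)
    (u₀ z₀ : ℝ) :
    ∃ f : ℝ → ℝ × ℝ, f 0 = (u₀, z₀) ∧ ∀ t ∈ Icc 0 T,
      HasDerivWithinAt f (a t * (f t).2, b t * φ (f t).1) (Icc 0 T) t := by
  have hA0 : 0 ≤ A := (abs_nonneg _).trans (hA 0 ⟨le_rfl, hT⟩)
  have hB0 : 0 ≤ B := (abs_nonneg _).trans (hB 0 ⟨le_rfl, hT⟩)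
  have hP0 : 0 ≤ P := (abs_nonneg _).trans (hP 0)
  set L : ℝ := B * P + 1 with hLdef
  have hL0 : 0 ≤ L := by positivity
  set N : ℝ := A * (|z₀| + L * T) + 1 with hNdef
  have hN0 : 0 < N := by positivity
  have hPL : IsPicardLindelof (fun t (x : ℝ × ℝ) => (a t / N * x.2, b t * φ (N * x.1)))
      (⟨0, le_rfl, hT⟩ : Icc (0 : ℝ) T) (u₀ / N, z₀) (L * T).toNNReal 0 L.toNNReal
      (A / N + B * Kφ * N).toNNReal := by
    refine ⟨fun t ht => (lipschitzWith_triangular hφ ?_ (hB t ht) hN0.le).lipschitzOnWith,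
      fun x _ => ?_, fun t ht x hx => ?_, ?_⟩
    · rw [abs_div, abs_of_pos hN0]
      exact div_le_div_of_nonneg_right (hA t ht) hN0.le
    · fun_prop
    · rw [Real.coe_toNNReal _ (by positivity)] at hx
      rw [Real.coe_toNNReal _ hL0, Prod.norm_def]
      refine max_le ?_ ?_
      · have h2 : |x.2 - z₀| ≤ L * T := by
          rw [← Real.dist_eq]
          exact (le_max_right _ _).trans (Metric.mem_closedBall.1 hx)
        have h3 : |x.2| ≤ |z₀| + L * T := by
          have := abs_add_le (x.2 - z₀) z₀
          rw [sub_add_cancel] at this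
          linarith
        rw [Real.norm_eq_abs, abs_mul, abs_div, abs_of_pos hN0]
        have h4 : |a t| * |x.2| ≤ A * (|z₀| + L * T) :=
          mul_le_mul (hA t ht) h3 (abs_nonneg _) hA0
        calc |a t| / N * |x.2| = |a t| * |x.2| / N := by ring
          _ ≤ 1 := by rw [div_le_one hN0]; linarith
          _ ≤ L := by rw [hLdef]; exact le_add_of_nonneg_left (by positivity)
      · rw [Real.norm_eq_abs, abs_mul]
        have := mul_le_mul (hB t ht) (hP (N * x.1)) (abs_nonneg _) hB0
        linarith
    · rw [Real.coe_toNNReal _ hL0, Real.coe_toNNReal _ (by positivity)]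
      simp [hT]
  obtain ⟨g, hg0, hg⟩ := hPL.exists_eq_forall_mem_Icc_hasDerivWithinAt₀
  refine ⟨fun t => (N * (g t).1, (g t).2), ?_, fun t ht => ?_⟩
  · have hg0' : g 0 = (u₀ / N, z₀) := hg0
    simp only [hg0', Prod.mk.injEq, and_true]
    field_simp
  · have h := hg t ht
    have h1 := (h.hasFDerivWithinAt.fst).hasDerivWithinAt.const_mul N
    have h2 := (h.hasFDerivWithinAt.snd).hasDerivWithinAt
    have h3 := h1.prodMk h2
    convert h3 using 1
    simp
    field_simp

/-- Truncating at u₀ removes the singularity; it changes nothing for a function that stays above u₀.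
-/
lemma lipschitzWith_inv_max_pow_three {u₀ : ℝ} (hu : 0 < u₀) :
    LipschitzWith (3 / u₀ ^ 4).toNNReal (fun u => 1 / max u u₀ ^ 3) := by
  refine LipschitzWith.of_dist_le_mul fun x y => ?_
  rw [Real.coe_toNNReal _ (by positivity), Real.dist_eq, Real.dist_eq]
  have hm : |max y u₀ - max x u₀| ≤ |x - y| := by
    rw [abs_sub_comm x y]; exact abs_max_sub_max_le_abs _ _ _
  have hx : u₀ ≤ max x u₀ := le_max_right _ _
  have hy : u₀ ≤ max y u₀ := le_max_right _ _
  set p := max x u₀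
  set q := max y u₀
  have hp : 0 < p := hu.trans_le hx
  have hq : 0 < q := hu.trans_le hy
  have e : 1 / p ^ 3 - 1 / q ^ 3
      = (q - p) * (1 / (p * q ^ 3) + 1 / (p ^ 2 * q ^ 2) + 1 / (p ^ 3 * q)) := by
    field_simp; ring
  rw [e, abs_mul, abs_of_nonneg (show 0 ≤ 1 / (p * q ^ 3) + 1 / (p ^ 2 * q ^ 2) + 1 / (p ^ 3 * q)
    by positivity), mul_comm]
  refine mul_le_mul ?_ hm (abs_nonneg _) (by positivity)
  have h1 : 1 / (p * q ^ 3) ≤ 1 / u₀ ^ 4 := by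
    rw [show u₀ ^ 4 = u₀ * u₀ ^ 3 by ring]; gcongr
  have h2 : 1 / (p ^ 2 * q ^ 2) ≤ 1 / u₀ ^ 4 := by
    rw [show u₀ ^ 4 = u₀ ^ 2 * u₀ ^ 2 by ring]; gcongr
  have h3 : 1 / (p ^ 3 * q) ≤ 1 / u₀ ^ 4 := by
    rw [show u₀ ^ 4 = u₀ ^ 3 * u₀ by ring]; gcongr
  calc _ ≤ 1 / u₀ ^ 4 + 1 / u₀ ^ 4 + 1 / u₀ ^ 4 := by gcongr
    _ = 3 / u₀ ^ 4 := by ring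

lemma exists_solution_triangular_Ici {φ : ℝ → ℝ} {Kφ : NNReal} (hφ : LipschitzWith Kφ φ)
    {P : ℝ} (hP : ∀ x, |φ x| ≤ P) {a b : ℝ → ℝ} (ha : Continuous a) (hb : Continuous b)
    (u₀ z₀ : ℝ) :
    ∃ u z : ℝ → ℝ, u 0 = u₀ ∧ z 0 = z₀ ∧
      (∀ t, 0 ≤ t → HasDerivWithinAt u (a t * z t) (Ici 0) t) ∧
      (∀ t, 0 ≤ t → HasDerivWithinAt z (b t * φ (u t)) (Ici 0) t) := by
  have hbd : ∀ (g : ℝ → ℝ), Continuous g → ∀ n : ℕ, ∃ A, ∀ t ∈ Icc (0 : ℝ) n, |g t| ≤ A :=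
    fun g hg n => isCompact_Icc.exists_bound_of_continuousOn hg.continuousOn
  obtain ⟨f, hf0, hf⟩ := exists_solution_Ici_of_forall_Icc
    (fun t (x : ℝ × ℝ) => (a t * x.2, b t * φ x.1)) (u₀, z₀)
    (fun n => by
      obtain ⟨A, hA⟩ := hbd a ha n
      obtain ⟨B, hB⟩ := hbd b hb n
      refine ⟨(A + B * Kφ * 1).toNNReal, fun t ht => ?_⟩
      simpa only [one_mul] using
        lipschitzWith_triangular hφ (hA t ht) (hB t ht) zero_le_one)
    (fun n => by
      obtain ⟨A, hA⟩ := hbd a ha n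
      obtain ⟨B, hB⟩ := hbd b hb n
      exact exists_solution_triangular_Icc hφ hP ha hb n.cast_nonneg hA hB u₀ z₀)
  refine ⟨fun t => (f t).1, fun t => (f t).2, by simp [hf0], by simp [hf0],
    fun t ht => ?_, fun t ht => ?_⟩
  · simpa using (hf t ht).hasFDerivWithinAt.fst.hasDerivWithinAt
  · simpa using (hf t ht).hasFDerivWithinAt.snd.hasDerivWithinAt

/-! ### Initial data and existence of the motion. -/

namespace Data

variable (d : Data)

lemma E_pos : 0 < d.E := by
  have := d.Δ_pos
  have := d.dr₀_pos
  have := d.ds₀_pos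
  unfold E; positivity

lemma t₀_pos : 0 < d.t₀ := div_pos (neg_pos.2 d.s₀_neg) d.ds₀_pos

lemma η_pos (k : ℝ) : 0 < d.η k := Real.exp_pos _

lemma ε_pos (k : ℝ) : 0 < d.ε k := Real.exp_pos _

lemma ε_lt_one {k : ℝ} (hk : 0 < k) : d.ε k < 1 := by
  have := d.t₀_pos
  have := Real.sqrt_pos.2 hk
  have := sub_neg.2 d.ξ₂_lt_ξ₁
  rw [ε, Real.exp_lt_one_iff, mul_assoc]
  exact mul_neg_of_neg_of_pos this (by positivity)

lemma initR_pos {k : ℝ} (hk : 0 < k) : 0 < d.initR k := by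
  have := sub_pos.2 (d.ε_lt_one hk)
  have := d.η_pos k
  have := d.dr₀_pos
  have := d.sqrt_Δ_pos
  unfold initR; positivity

lemma initV_sub (k : ℝ) : d.initV k - d.ξ₁ * d.initR k = d.η k * d.dr₀ * d.ε k := by
  have h1 := d.sqrt_Δ_pos.ne'
  have h2 := d.ξ₁_neg.ne
  have h3 := d.ξ_sub
  unfold initV initR
  field_simp
  linear_combination d.η k * d.dr₀ * d.ε k * h3

lemma initV_sub_pos (k : ℝ) : 0 < d.initV k - d.ξ₁ * d.initR k := by
  have := d.η_pos k
  have := d.ε_pos k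
  have := d.dr₀_pos
  rw [initV_sub]; positivity

/-- The factors `u = exp(-ξ₁ t) R` and `z = exp(-ξ₂ t) (Ṙ - ξ₁ R)` are nondecreasing, which keeps
`R` away from the singularity. -/
lemma exists_isScaledMotion {k : ℝ} (hk : 0 < k) : ∃ R V : ℝ → ℝ, d.IsScaledMotion k R V := by
  have hu₀ := d.initR_pos hk
  have hz₀ := d.initV_sub_pos k
  have hm := d.ξ_mul
  have ha := d.ξ_add
  set e := d.E * (1 - d.ε k) ^ 2 with he
  have he0 : 0 ≤ e := mul_nonneg d.E_pos.le (sq_nonneg _)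
  -- In these variables the equation is u' = exp((ξ₂ - ξ₁)t) z, z' = e exp(-(ξ₂ + 3ξ₁)t)/u³. The
  -- truncation at `initR` is inactive because u is nondecreasing.
  obtain ⟨u, z, hu0, hz0, hu, hz⟩ := exists_solution_triangular_Ici
    (lipschitzWith_inv_max_pow_three hu₀) (P := 1 / d.initR k ^ 3)
    (fun x => by
      have h : d.initR k ≤ max x (d.initR k) := le_max_right _ _
      rw [abs_of_nonneg (by positivity)]
      gcongr)
    (a := fun t => Real.exp ((d.ξ₂ - d.ξ₁) * t))
    (b := fun t => e * Real.exp (-(d.ξ₂ + 3 * d.ξ₁) * t)) (by fun_prop) (by fun_prop)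
    (d.initR k) (d.initV k - d.ξ₁ * d.initR k)
  have hzp : ∀ t, 0 ≤ t → 0 < z t := fun t ht => by
    have := le_of_hasDerivWithinAt_nonneg le_rfl ht hz (fun s _ => by positivity)
    linarith
  have hup : ∀ t, 0 ≤ t → d.initR k ≤ u t := fun t ht => by
    have := le_of_hasDerivWithinAt_nonneg le_rfl ht hu
      (fun s hs => mul_nonneg (Real.exp_pos _).le (hzp s hs.1).le)
    linarith
  have hR : ∀ t, 0 ≤ t → HasDerivWithinAt (fun t => Real.exp (d.ξ₁ * t) * u t)
      (d.ξ₁ * (Real.exp (d.ξ₁ * t) * u t) + Real.exp (d.ξ₂ * t) * z t) (Ici 0) t := fun t ht => by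
    refine ((hasDerivWithinAt_exp_mul d.ξ₁ t).mul (hu t ht)).congr_deriv ?_
    have : Real.exp (d.ξ₂ * t) = Real.exp (d.ξ₁ * t) * Real.exp ((d.ξ₂ - d.ξ₁) * t) := by
      rw [← Real.exp_add]; ring_nf
    rw [this]; ring
  have hW : ∀ t, 0 ≤ t → HasDerivWithinAt (fun t => Real.exp (d.ξ₂ * t) * z t)
      (d.ξ₂ * (Real.exp (d.ξ₂ * t) * z t) + e / (Real.exp (d.ξ₁ * t) * u t) ^ 3) (Ici 0) t :=
    fun t ht => by
    refine ((hasDerivWithinAt_exp_mul d.ξ₂ t).mul (hz t ht)).congr_deriv ?_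
    have h1 : Real.exp (d.ξ₂ * t) * Real.exp (-(d.ξ₂ + 3 * d.ξ₁) * t)
        = (Real.exp (d.ξ₁ * t) ^ 3)⁻¹ := by
      rw [← Real.exp_add, ← Real.exp_nat_mul, ← Real.exp_neg]; push_cast; ring_nf
    rw [max_eq_left (hup t ht), mul_pow, div_eq_mul_inv e, mul_inv, ← h1]
    ring
  refine ⟨fun t => Real.exp (d.ξ₁ * t) * u t,
    fun t => d.ξ₁ * (Real.exp (d.ξ₁ * t) * u t) + Real.exp (d.ξ₂ * t) * z t,
    fun t ht => mul_pos (Real.exp_pos _) (hu₀.trans_le (hup t ht)), by simp [hu0],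
    by simp [hu0, hz0], hR, fun t ht => ?_⟩
  refine (((hR t ht).const_mul d.ξ₁).add (hW t ht)).congr_deriv ?_
  linear_combination (Real.exp (d.ξ₁ * t) * u t) * (d.ξ₁ * ha - hm)
    + (Real.exp (d.ξ₂ * t) * z t) * ha

end Data

/-! ### Monotone quantities and the initial repulsion. -/

namespace Data

variable {d : Data}

namespace IsScaledMotion

variable {k : ℝ} {R V : ℝ → ℝ}

lemma hasDerivWithinAt_exp_mul_R (h : d.IsScaledMotion k R V) {t : ℝ} (ht : 0 ≤ t) :
    HasDerivWithinAt (fun t => Real.exp (-d.ξ₁ * t) * R t)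
      (Real.exp (-d.ξ₁ * t) * (V t - d.ξ₁ * R t)) (Ici 0) t := by
  refine ((hasDerivWithinAt_exp_mul (-d.ξ₁) t).mul (h.deriv_R t ht)).congr_deriv ?_
  ring

/-- By the factorization (d/dt - ξ₂)(d/dt - ξ₁), only the repulsive force drives Ṙ - ξ₁R. -/
lemma hasDerivWithinAt_exp_mul_sub (h : d.IsScaledMotion k R V) {t : ℝ} (ht : 0 ≤ t) :
    HasDerivWithinAt (fun t => Real.exp (-d.ξ₂ * t) * (V t - d.ξ₁ * R t))
      (Real.exp (-d.ξ₂ * t) * (d.E * (1 - d.ε k) ^ 2 / R t ^ 3)) (Ici 0) t := by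
  have h1 := (h.deriv_V t ht).sub ((h.deriv_R t ht).const_mul d.ξ₁)
  refine ((hasDerivWithinAt_exp_mul (-d.ξ₂) t).mul h1).congr_deriv ?_
  simp only [Pi.sub_apply]
  linear_combination Real.exp (-d.ξ₂ * t) * (V t * (-d.ξ_add) + R t * d.ξ_mul)

lemma force_nonneg (h : d.IsScaledMotion k R V) {t : ℝ} (ht : 0 ≤ t) :
    0 ≤ d.E * (1 - d.ε k) ^ 2 / R t ^ 3 := by
  have := h.pos t ht
  have := d.E_pos
  positivity

lemma exp_mul_sub_mono (h : d.IsScaledMotion k R V) {s t : ℝ} (hs : 0 ≤ s) (hst : s ≤ t) :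
    Real.exp (-d.ξ₂ * s) * (V s - d.ξ₁ * R s) ≤ Real.exp (-d.ξ₂ * t) * (V t - d.ξ₁ * R t) :=
  le_of_hasDerivWithinAt_nonneg hs hst (fun _ => h.hasDerivWithinAt_exp_mul_sub)
    fun _ hτ => mul_nonneg (Real.exp_pos _).le (h.force_nonneg (hs.trans hτ.1))

lemma sub_pos (h : d.IsScaledMotion k R V) {t : ℝ} (ht : 0 ≤ t) : 0 < V t - d.ξ₁ * R t := by
  have h1 := h.exp_mul_sub_mono le_rfl ht
  rw [h.init_R, h.init_V, mul_zero, Real.exp_zero, one_mul] at h1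
  exact pos_of_mul_pos_right ((d.initV_sub_pos k).trans_le h1) (Real.exp_pos _).le

lemma exp_mul_R_mono (h : d.IsScaledMotion k R V) {s t : ℝ} (hs : 0 ≤ s) (hst : s ≤ t) :
    Real.exp (-d.ξ₁ * s) * R s ≤ Real.exp (-d.ξ₁ * t) * R t :=
  le_of_hasDerivWithinAt_nonneg hs hst (fun _ => h.hasDerivWithinAt_exp_mul_R)
    fun _ hτ => mul_nonneg (Real.exp_pos _).le (h.sub_pos (hs.trans hτ.1)).le

/-- The repulsive force produces a velocity of order `1 / R(0)` within a time `R(0)²`. -/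
lemma exists_div_le_sub (h : d.IsScaledMotion k R V) (hk : 0 < k) (ha1 : d.initR k ≤ 1)
    {c : ℝ} (hc1 : c ≤ 1) (hc : c ≤ d.E * (1 - d.ε k) ^ 2 * Real.exp d.ξ₂ / 8) :
    ∃ s, 0 ≤ s ∧ s ≤ 1 ∧ c / d.initR k ≤ V s - d.ξ₁ * R s := by
  have ha := d.initR_pos hk
  have hξ₁ := d.ξ₁_neg
  have hξ₂ := d.ξ₂_neg
  set a := d.initR k with ha'
  set e := d.E * (1 - d.ε k) ^ 2 with he
  have he0 : 0 ≤ e := mul_nonneg d.E_pos.le (sq_nonneg _)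
  have ha2 : a ^ 2 ≤ 1 := pow_le_one₀ ha.le ha1
  -- If w < c/a throughout [0, 1], then Ṙ < 1/a, so R ≤ 2a on [0, a²]. The force is then at least
  -- e/(8a³), and over a time a² it raises exp(-ξ₂t)w by e/(8a), too much for this choice of c.
  by_contra! hcon
  have hR : ∀ s, 0 ≤ s → s ≤ a ^ 2 → R s ≤ 2 * a := by
    intro s hs hsa
    have h1 := le_of_hasDerivWithinAt_nonneg le_rfl hs
      (f := fun t => 1 / a * t - R t) (f' := fun t => 1 / a * 1 - V t)
      (fun t ht => ((hasDerivWithinAt_id t _).const_mul (1 / a)).sub (h.deriv_R t ht))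
      (fun t ht => by
        have h2 := hcon t ht.1 (ht.2.trans (hsa.trans ha2))
        have h3 : c / a ≤ 1 / a := by gcongr
        have h4 := mul_neg_of_neg_of_pos hξ₁ (h.pos t ht.1)
        linarith)
    simp only [mul_zero, h.init_R] at h1
    have h5 : 1 / a * s ≤ a := by
      rw [one_div, inv_mul_le_iff₀ ha]; nlinarith
    linarith
  have hw := le_of_hasDerivWithinAt_nonneg le_rfl (sq_nonneg a)
    (f := fun t => Real.exp (-d.ξ₂ * t) * (V t - d.ξ₁ * R t) - e / (8 * a ^ 3) * t)
    (fun t ht => (h.hasDerivWithinAt_exp_mul_sub ht).sub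
      ((hasDerivWithinAt_id t _).const_mul (e / (8 * a ^ 3))))
    (fun t ht => by
      have hp := h.pos t ht.1
      have h1 : e / (8 * a ^ 3) ≤ e / R t ^ 3 := by
        rw [show 8 * a ^ 3 = (2 * a) ^ 3 by ring]
        have := hR t ht.1 ht.2
        gcongr
      have h2 : 1 ≤ Real.exp (-d.ξ₂ * t) := Real.one_le_exp (by nlinarith [ht.1])
      have h3 := h.force_nonneg ht.1
      rw [← he] at h3 ⊢
      nlinarith)
  simp only [mul_zero, Real.exp_zero, one_mul, sub_zero] at hw
  have h0 := h.sub_pos le_rfl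
  have h1 := hcon (a ^ 2) (sq_nonneg a) ha2
  have h2 : e / (8 * a ^ 3) * a ^ 2 = e / 8 / a := by field_simp
  have h3 : Real.exp (-d.ξ₂ * a ^ 2) ≤ Real.exp (-d.ξ₂) := Real.exp_le_exp.2 (by nlinarith)
  have h4 : Real.exp (-d.ξ₂ * a ^ 2) * (V (a ^ 2) - d.ξ₁ * R (a ^ 2)) ≤
      Real.exp (-d.ξ₂) * (V (a ^ 2) - d.ξ₁ * R (a ^ 2)) :=
    mul_le_mul_of_nonneg_right h3 (h.sub_pos (sq_nonneg a)).le
  have h5 : Real.exp (-d.ξ₂) * (c / a) ≤ e / 8 / a := by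
    rw [← mul_div_assoc]
    gcongr
    calc Real.exp (-d.ξ₂) * c ≤ Real.exp (-d.ξ₂) * (e * Real.exp d.ξ₂ / 8) := by gcongr
      _ = e / 8 * (Real.exp (-d.ξ₂) * Real.exp d.ξ₂) := by ring
      _ = e / 8 := by rw [← Real.exp_add]; simp
  have h6 := mul_lt_mul_of_pos_left h1 (Real.exp_pos (-d.ξ₂))
  linarith

/-- The value of w reached by time 1 loses at most a factor exp(2ξ₂) up to time 2, so exp(-ξ₁t)R
gains that amount on [1, 2] and never loses it. -/
lemma exp_mul_le_R (h : d.IsScaledMotion k R V) (hk : 0 < k) (ha1 : d.initR k ≤ 1)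
    {c : ℝ} (hc0 : 0 ≤ c) (hc1 : c ≤ 1)
    (hc : c ≤ d.E * (1 - d.ε k) ^ 2 * Real.exp d.ξ₂ / 8) {t : ℝ} (ht : 2 ≤ t) :
    Real.exp (d.ξ₁ * t) * (Real.exp (2 * d.ξ₂) * (c / d.initR k)) ≤ R t := by
  have ha := d.initR_pos hk
  have hξ₁ := d.ξ₁_neg
  have hξ₂ := d.ξ₂_neg
  obtain ⟨s, hs0, hs1, hs⟩ := h.exists_div_le_sub hk ha1 hc1 hc
  have hca : 0 ≤ c / d.initR k := by positivity
  have hw : ∀ τ ∈ Icc (1 : ℝ) 2, Real.exp (2 * d.ξ₂) * (c / d.initR k) ≤ V τ - d.ξ₁ * R τ := by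
    intro τ hτ
    have h1 := h.exp_mul_sub_mono hs0 (hs1.trans hτ.1)
    have h2 := mul_le_mul_of_nonneg_left h1 (Real.exp_pos (d.ξ₂ * τ)).le
    rw [← mul_assoc, ← mul_assoc, ← Real.exp_add, ← Real.exp_add,
      show d.ξ₂ * τ + -d.ξ₂ * τ = 0 by ring, Real.exp_zero, one_mul] at h2
    refine le_trans ?_ h2
    refine mul_le_mul (Real.exp_le_exp.2 ?_) hs hca (Real.exp_pos _).le
    nlinarith [hτ.2]
  have h1 := le_of_hasDerivWithinAt_nonneg zero_le_one one_le_two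
    (f := fun t => Real.exp (-d.ξ₁ * t) * R t - Real.exp (2 * d.ξ₂) * (c / d.initR k) * t)
    (fun t ht => (h.hasDerivWithinAt_exp_mul_R ht).sub
      ((hasDerivWithinAt_id t _).const_mul (Real.exp (2 * d.ξ₂) * (c / d.initR k))))
    (fun τ hτ => by
      have h2 : 1 ≤ Real.exp (-d.ξ₁ * τ) := Real.one_le_exp (by nlinarith [hτ.1])
      have h3 := hw τ hτ
      have h4 : 0 < V τ - d.ξ₁ * R τ := h.sub_pos (zero_le_one.trans hτ.1)
      nlinarith)
  have h2 := h.exp_mul_R_mono zero_le_two ht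
  have h3 : 0 < Real.exp (-d.ξ₁ * 1) * R 1 := mul_pos (Real.exp_pos _) (h.pos 1 zero_le_one)
  have h4 : Real.exp (2 * d.ξ₂) * (c / d.initR k) ≤ Real.exp (-d.ξ₁ * t) * R t := by linarith
  calc _ ≤ Real.exp (d.ξ₁ * t) * (Real.exp (-d.ξ₁ * t) * R t) := by gcongr
    _ = R t := by rw [← mul_assoc, ← Real.exp_add]; simp

/-! ### Energy dissipation, Lyapunov decay and the first hitting time. -/

lemma F_antitone (h : d.IsScaledMotion k R V) {s t : ℝ} (hs : 0 ≤ s) (hst : s ≤ t) :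
    d.F k (R t) (V t) ≤ d.F k (R s) (V s) := by
  have hα : 0 < d.α := by linarith [d.one_lt_α]
  have := le_of_hasDerivWithinAt_nonneg hs hst (f := fun t => -d.F k (R t) (V t))
    (f' := fun t => 4 * d.α * V t ^ 2)
    (fun τ hτ => by
      have hp := (h.pos τ hτ).ne'
      have h1 := (h.deriv_R τ hτ).pow 2
      have h2 := (hasDerivWithinAt_const τ (Ici 0) (d.E * (1 - d.ε k) ^ 2)).div h1
        (pow_ne_zero 2 hp)
      refine ((h1.add h2).add ((h.deriv_V τ hτ).pow 2)).neg.congr_deriv ?_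
      simp only [Pi.pow_apply]
      field_simp
      ring)
    (fun τ _ => by positivity)
  simpa using this

/-- The Lyapunov equation for Q yields -|x|²; the rest is the force times 2(Qx)₂ = R + Ṙ/α. -/
lemma hasDerivWithinAt_quadForm (h : d.IsScaledMotion k R V) {t : ℝ} (ht : 0 ≤ t) :
    HasDerivWithinAt (fun t => d.quadForm (R t) (V t))
      (-(R t ^ 2 + V t ^ 2) + (R t + 1 / d.α * V t) * (d.E * (1 - d.ε k) ^ 2 / R t ^ 3))
      (Ici 0) t := by
  have hα : d.α ≠ 0 := by linarith [d.one_lt_α]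
  simp only [d.quadForm_eq]
  have h1 := ((h.deriv_R t ht).pow 2).const_mul (d.α + 1 / (2 * d.α))
  have h2 := (h.deriv_R t ht).mul (h.deriv_V t ht)
  have h3 := ((h.deriv_V t ht).pow 2).const_mul (1 / (2 * d.α))
  refine ((h1.add h2).add h3).congr_deriv ?_
  field_simp
  ring

/-- The quadratic form decays at the rate `1 / (2 λ₂)` as long as `R ≥ R̄`. -/
lemma quadForm_deriv_le (h : d.IsScaledMotion k R V) (hk : 0 < k) {Rbar t : ℝ} (hR0 : 0 < Rbar)
    (hthr : 4 * d.E * (d.lam₂ * Real.sqrt d.lam₂) ≤ Real.sqrt d.lam₁ * Rbar ^ 4)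
    (ht : 0 ≤ t) (hRt : Rbar ≤ R t) :
    -(R t ^ 2 + V t ^ 2) + (R t + 1 / d.α * V t) * (d.E * (1 - d.ε k) ^ 2 / R t ^ 3)
      ≤ -(1 / (2 * d.lam₂)) * d.quadForm (R t) (V t) := by
  have hα : 0 < d.α := by linarith [d.one_lt_α]
  have hl₁ := d.lam₁_pos
  have hl₂ := d.lam₂_pos
  have hRp := h.pos t ht
  have hE := d.E_pos
  have hε := d.ε_pos k
  have hε1 := d.ε_lt_one hk
  have hlow := d.lam₁_mul_le_quadForm (R t) (V t)
  have hup := d.quadForm_le_lam₂_mul (R t) (V t)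
  have hq := d.quadForm_eq (R t) (V t)
  have hf := h.force_nonneg ht
  set q := d.quadForm (R t) (V t)
  set g := d.E * (1 - d.ε k) ^ 2 / R t ^ 3 with hg
  have hq0 : 0 ≤ q := le_trans (by positivity) hlow
  have hcl : 1 / (2 * d.α) ≤ d.lam₂ := by linarith [d.lt_lam₂]
  -- Cauchy–Schwarz for Q: (Qx)₂² ≤ Q₂₂ · x*Qx, with Q₂₂ = 1/(2α) ≤ λ₂.
  have hcs : R t + 1 / d.α * V t ≤ 2 * (Real.sqrt d.lam₂ * Real.sqrt q) := by
    rw [← Real.sqrt_mul hl₂.le]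
    have h1 : (R t + 1 / d.α * V t) / 2 ≤ Real.sqrt (d.lam₂ * q) := by
      refine Real.le_sqrt_of_sq_le ?_
      refine le_trans ?_ (mul_le_mul_of_nonneg_right hcl hq0)
      have h2 : 1 / (2 * d.α) * q - ((R t + 1 / d.α * V t) / 2) ^ 2
          = (1 / 4 + 1 / (4 * d.α ^ 2)) * R t ^ 2 := by
        rw [hq]; field_simp; ring
      have h3 : 0 ≤ (1 / 4 + 1 / (4 * d.α ^ 2)) * R t ^ 2 := by positivity
      linarith
    linarith
  have hgE : g * R t ^ 3 ≤ d.E := by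
    rw [hg, div_mul_cancel₀ _ (by positivity)]
    have : (1 - d.ε k) ^ 2 ≤ 1 := by nlinarith
    nlinarith
  have hsq : Real.sqrt d.lam₁ * R t ≤ Real.sqrt q := by
    refine Real.le_sqrt_of_sq_le ?_
    rw [mul_pow, Real.sq_sqrt hl₁.le]
    nlinarith [mul_nonneg hl₁.le (sq_nonneg (V t))]
  -- This is where the threshold enters: the force is at most E/R³, while √q ≥ √λ₁ R and R ≥ R̄.
  have hmain : 4 * (d.lam₂ * Real.sqrt d.lam₂) * g ≤ Real.sqrt q := by
    refine le_trans ?_ hsq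
    have h1 : Rbar ^ 4 ≤ R t ^ 4 := by gcongr
    have h2 : 4 * (d.lam₂ * Real.sqrt d.lam₂) * (g * R t ^ 3)
        ≤ Real.sqrt d.lam₁ * R t * R t ^ 3 := by
      calc _ ≤ 4 * (d.lam₂ * Real.sqrt d.lam₂) * d.E := by gcongr
        _ = 4 * d.E * (d.lam₂ * Real.sqrt d.lam₂) := by ring
        _ ≤ Real.sqrt d.lam₁ * Rbar ^ 4 := hthr
        _ ≤ Real.sqrt d.lam₁ * R t ^ 4 := by gcongr
        _ = _ := by ring
    rw [← mul_assoc] at h2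
    exact le_of_mul_le_mul_right h2 (by positivity)
  have h1 : (R t + 1 / d.α * V t) * g ≤ 2 * (Real.sqrt d.lam₂ * Real.sqrt q) * g :=
    mul_le_mul_of_nonneg_right hcs hf
  have h2 : 2 * (Real.sqrt d.lam₂ * Real.sqrt q) * g * (2 * d.lam₂) ≤ q := by
    calc _ = 4 * (d.lam₂ * Real.sqrt d.lam₂) * g * Real.sqrt q := by ring
      _ ≤ Real.sqrt q * Real.sqrt q := by gcongr
      _ = q := Real.mul_self_sqrt hq0
  have h3 : 2 * (Real.sqrt d.lam₂ * Real.sqrt q) * g ≤ q / (2 * d.lam₂) := by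
    rwa [le_div_iff₀ (by positivity)]
  have h4 : q / d.lam₂ ≤ R t ^ 2 + V t ^ 2 := by
    rw [div_le_iff₀ hl₂]; linarith
  have h5 : -(1 / (2 * d.lam₂)) * q = q / (2 * d.lam₂) - q / d.lam₂ := by field_simp; ring
  linarith

/-- Compare the decay of exp(τ/(2λ₂)) x*Qx on [s, t] with the lower bound λ₁R̄² at t, and take
logarithms. -/
lemma sub_le_of_forall_le (h : d.IsScaledMotion k R V) (hk : 0 < k) {Rbar s t : ℝ}
    (hR0 : 0 < Rbar)
    (hthr : 4 * d.E * (d.lam₂ * Real.sqrt d.lam₂) ≤ Real.sqrt d.lam₁ * Rbar ^ 4)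
    (hs : 0 ≤ s) (hst : s ≤ t) (hRt : ∀ τ ∈ Icc s t, Rbar ≤ R τ) :
    t - s ≤ 2 * d.lam₂ *
      (Real.log (d.quadForm (R s) (V s)) - Real.log (d.lam₁ * Rbar ^ 2)) := by
  have hl₁ := d.lam₁_pos
  have hl₂ := d.lam₂_pos
  have hdecay := le_of_hasDerivWithinAt_nonneg hs hst
    (fun τ hτ => ((hasDerivWithinAt_exp_mul (1 / (2 * d.lam₂)) τ).mul
      (h.hasDerivWithinAt_quadForm hτ)).neg)
    (fun τ hτ => by
      have h1 := h.quadForm_deriv_le hk hR0 hthr (hs.trans hτ.1) (hRt τ hτ)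
      have h2 := Real.exp_pos (1 / (2 * d.lam₂) * τ)
      have h3 := mul_le_mul_of_nonneg_left h1 h2.le
      linarith)
  simp only [Pi.neg_apply, Pi.mul_apply, neg_le_neg_iff] at hdecay
  have hlow : d.lam₁ * Rbar ^ 2 ≤ d.quadForm (R t) (V t) := by
    refine le_trans ?_ (d.lam₁_mul_le_quadForm (R t) (V t))
    have : Rbar ^ 2 ≤ R t ^ 2 := by
      have := hRt t ⟨hst, le_rfl⟩
      gcongr
    nlinarith [sq_nonneg (V t)]
  have hp : 0 < d.lam₁ * Rbar ^ 2 := by positivity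
  have hqs : 0 < d.quadForm (R s) (V s) := by
    refine lt_of_lt_of_le ?_ (d.lam₁_mul_le_quadForm (R s) (V s))
    have := h.pos s hs
    positivity
  have h1 : Real.exp (1 / (2 * d.lam₂) * t) * (d.lam₁ * Rbar ^ 2)
      ≤ Real.exp (1 / (2 * d.lam₂) * s) * d.quadForm (R s) (V s) :=
    le_trans (by gcongr) hdecay
  have h2 := Real.log_le_log (by positivity) h1
  rw [Real.log_mul (Real.exp_pos _).ne' hp.ne', Real.log_mul (Real.exp_pos _).ne' hqs.ne',
    Real.log_exp, Real.log_exp] at h2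
  have h3 : 1 / (2 * d.lam₂) * (t - s)
      ≤ Real.log (d.quadForm (R s) (V s)) - Real.log (d.lam₁ * Rbar ^ 2) := by linarith
  have h4 := mul_le_mul_of_nonneg_left h3 (show 0 ≤ 2 * d.lam₂ by positivity)
  rwa [← mul_assoc, mul_one_div_cancel (by positivity), one_mul] at h4

lemma continuousOn_R (h : d.IsScaledMotion k R V) : ContinuousOn R (Ici 0) :=
  fun t ht => (h.deriv_R t ht).continuousWithinAt

lemma exists_first_hitting (h : d.IsScaledMotion k R V) (hk : 0 < k) {Rbar s : ℝ}
    (hR0 : 0 < Rbar)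
    (hthr : 4 * d.E * (d.lam₂ * Real.sqrt d.lam₂) ≤ Real.sqrt d.lam₁ * Rbar ^ 4)
    (hs : 0 ≤ s) (hRs : Rbar < R s) :
    ∃ t, IsLeast {τ : ℝ | s ≤ τ ∧ R τ = Rbar} t ∧
      t ≤ s + 2 * d.lam₂ *
        (Real.log (d.quadForm (R s) (V s)) - Real.log (d.lam₁ * Rbar ^ 2)) ∧ V t ≤ 0 := by
  have hcont : ContinuousOn R (Ici s) := h.continuousOn_R.mono (Ici_subset_Ici.2 hs)
  have hb := fun t => h.sub_le_of_forall_le hk (s := s) (t := t) hR0 hthr hs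
  set b := 2 * d.lam₂ * (Real.log (d.quadForm (R s) (V s)) - Real.log (d.lam₁ * Rbar ^ 2))
  have hivt : ∀ t, s ≤ t → R t < Rbar → ∃ τ, s ≤ τ ∧ τ < t ∧ R τ = Rbar := by
    intro t hst hRt
    obtain ⟨τ, hτ, hτR⟩ := intermediate_value_Icc' hst (hcont.mono Icc_subset_Ici_self)
      ⟨hRt.le, hRs.le⟩
    refine ⟨τ, hτ.1, lt_of_le_of_ne hτ.2 ?_, hτR⟩
    rintro rfl
    exact hRt.ne hτR
  have hb0 : 0 ≤ b := by
    have := hb s le_rfl (fun τ hτ => by rw [le_antisymm hτ.2 hτ.1]; exact hRs.le)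
    linarith
  have hne : {τ : ℝ | s ≤ τ ∧ R τ = Rbar}.Nonempty := by
    by_contra hn
    have := hb (s + b + 1) (by linarith) (fun τ hτ => by
      by_contra hlt
      obtain ⟨σ, h1, -, h2⟩ := hivt τ hτ.1 (not_le.1 hlt)
      exact hn ⟨σ, h1, h2⟩)
    linarith
  have hclosed : IsClosed {τ : ℝ | s ≤ τ ∧ R τ = Rbar} :=
    hcont.preimage_isClosed_of_isClosed isClosed_Ici (isClosed_singleton (x := Rbar))
  have hleast := hclosed.isLeast_csInf hne ⟨s, fun τ hτ => hτ.1⟩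
  set t := sInf {τ : ℝ | s ≤ τ ∧ R τ = Rbar}
  have hst : s < t := lt_of_le_of_ne hleast.1.1 (by
    intro he
    exact hRs.ne' (he ▸ hleast.1.2))
  have habove : ∀ τ ∈ Icc s t, Rbar ≤ R τ := by
    intro τ hτ
    by_contra hlt
    obtain ⟨σ, h1, h2, h3⟩ := hivt τ hτ.1 (not_le.1 hlt)
    exact absurd (hleast.2 ⟨h1, h3⟩) (not_le.2 (h2.trans_le hτ.2))
  refine ⟨t, hleast, by linarith [hb t hst.le habove], ?_⟩
  -- R ≥ R̄ before t, so the left difference quotients at t are nonpositive.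
  have hd : HasDerivWithinAt R (V t) (Iio t) t :=
    ((h.deriv_R t (hs.trans hst.le)).hasDerivAt (Ici_mem_nhds (hs.trans_lt hst))).hasDerivWithinAt
  rw [hasDerivWithinAt_iff_tendsto_slope' (by simp)] at hd
  refine le_of_tendsto hd ?_
  filter_upwards [self_mem_nhdsWithin, mem_nhdsWithin_of_mem_nhds (Ioi_mem_nhds hst)] with τ h1 h2
  have h3 := habove τ ⟨(mem_Ioi.1 h2).le, (mem_Iio.1 h1).le⟩
  rw [slope_def_field, hleast.1.2]
  exact div_nonpos_of_nonneg_of_nonpos (by linarith) (by linarith [mem_Iio.1 h1])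

end IsScaledMotion
end Data

/-! ### The threshold, limits as k → ∞ and energy bounds. -/

namespace Data

variable (d : Data)

lemma threshold_spec {Rbar : ℝ} (hRbar : d.threshold < Rbar) : 0 < Rbar ∧
    4 * d.E * (d.lam₂ * Real.sqrt d.lam₂) ≤ Real.sqrt d.lam₁ * Rbar ^ 4 := by
  have hE := d.E_pos
  have hl₁ := d.lam₁_pos
  have hl₂ := d.lam₂_pos
  obtain ⟨h1, h2⟩ := max_lt_iff.1 hRbar
  have h0 : 0 < Rbar := (Real.rpow_pos_of_pos hE _).trans h2
  refine ⟨h0, ?_⟩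
  have h32 : d.lam₂ ^ (3 / 2 : ℝ) = d.lam₂ * Real.sqrt d.lam₂ := by
    rw [Real.sqrt_eq_rpow, show (3 / 2 : ℝ) = 1 + 1 / 2 by norm_num, Real.rpow_add hl₂,
      Real.rpow_one]
  rw [h32, ← Real.sqrt_eq_rpow] at h1
  set y := 4 * d.E * (d.lam₂ * Real.sqrt d.lam₂) / Real.sqrt d.lam₁ with hy
  have hy0 : 0 ≤ y := by positivity
  have h3 : y ≤ Rbar ^ 4 := by
    calc y = (y ^ (1 / 4 : ℝ)) ^ 4 := by
          rw [← Real.rpow_natCast, ← Real.rpow_mul hy0]; norm_num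
      _ ≤ Rbar ^ 4 := by gcongr
  rw [hy, div_le_iff₀ (Real.sqrt_pos.2 hl₁)] at h3
  linarith

lemma log_one_div_η (k : ℝ) : Real.log (1 / d.η k) = -d.ξ₁ * d.t₀ / 2 * Real.sqrt k := by
  rw [one_div, Real.log_inv, η, Real.log_exp]; ring

lemma η_eq (k : ℝ) : d.η k = Real.exp (-Real.log (1 / d.η k)) := by
  rw [one_div, Real.log_inv, neg_neg, Real.exp_log (d.η_pos k)]

lemma tendsto_log_one_div_η :
    Filter.Tendsto (fun k => Real.log (1 / d.η k)) Filter.atTop Filter.atTop := by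
  simp only [log_one_div_η]
  have := d.t₀_pos
  have := d.ξ₁_neg
  exact Filter.Tendsto.const_mul_atTop (by nlinarith) Real.tendsto_sqrt_atTop

lemma tendsto_η : Filter.Tendsto d.η Filter.atTop (nhds 0) := by
  have := Real.tendsto_exp_neg_atTop_nhds_zero.comp d.tendsto_log_one_div_η
  refine this.congr fun k => ?_
  rw [Function.comp_apply, ← d.η_eq]

lemma tendsto_ε : Filter.Tendsto d.ε Filter.atTop (nhds 0) := by
  have h1 := d.t₀_pos
  have h2 := d.ξ₂_lt_ξ₁
  have := Real.tendsto_exp_neg_atTop_nhds_zero.comp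
    (Filter.Tendsto.const_mul_atTop (show 0 < (d.ξ₁ - d.ξ₂) * d.t₀ by nlinarith)
      Real.tendsto_sqrt_atTop)
  refine this.congr fun k => ?_
  rw [Function.comp_apply, ε]; ring_nf

lemma initR_eq (k : ℝ) :
    d.initR k = d.η k * (d.dr₀ / (2 * Real.sqrt d.Δ)) * (1 - d.ε k) := by
  unfold initR; ring

lemma initV_eq (k : ℝ) :
    d.initV k = d.η k * (d.dr₀ / (2 * Real.sqrt d.Δ)) * (d.ξ₁ - d.ε k * d.ξ₂) := by
  have := d.ξ₁_neg.ne
  unfold initV; field_simp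

/-- The singular term equals E/(Aη)², of order η⁻²; the other two are O(η²), hence also O(η⁻²) as η
≤ 1. -/
lemma F_init_le {k : ℝ} (hη : d.η k ≤ 1) (hε : d.ε k ≤ 1 / 2) {A : ℝ}
    (hA : A = d.dr₀ / (2 * Real.sqrt d.Δ)) :
    d.F k (d.initR k) (d.initV k)
      ≤ (A ^ 2 + 4 * d.E / A ^ 2 + A ^ 2 * (2 * d.α) ^ 2) / d.η k ^ 2 := by
  have hη0 := d.η_pos k
  have hε0 := d.ε_pos k
  have hE := d.E_pos
  have hA0 : 0 < A := by
    rw [hA]; exact div_pos d.dr₀_pos (mul_pos two_pos d.sqrt_Δ_pos)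
  have hξ₁ := d.ξ₁_neg
  have hξ₂ := d.ξ₂_neg
  have hξ := d.ξ_add
  rw [F, initR_eq, initV_eq, ← hA]
  set x := d.η k
  set y := d.ε k
  have hx2 : x ^ 2 * x ^ 2 ≤ 1 := by
    have : x ^ 2 ≤ 1 := pow_le_one₀ hη0.le hη
    nlinarith [sq_nonneg x]
  have hy1 : (1 - y) ^ 2 ≤ 1 := by nlinarith
  have hy2 : 1 / 4 ≤ (1 - y) ^ 2 := by nlinarith
  have hv : (d.ξ₁ - y * d.ξ₂) ^ 2 ≤ (2 * d.α) ^ 2 := sq_le_sq' (by nlinarith) (by nlinarith)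
  have h1 : (x * A * (1 - y)) ^ 2 ≤ A ^ 2 / x ^ 2 := by
    rw [le_div_iff₀ (by positivity)]
    calc (x * A * (1 - y)) ^ 2 * x ^ 2 = A ^ 2 * ((x ^ 2 * x ^ 2) * (1 - y) ^ 2) := by ring
      _ ≤ A ^ 2 * (1 * 1) := by gcongr
      _ = A ^ 2 := by ring
  have h3 : (x * A * (d.ξ₁ - y * d.ξ₂)) ^ 2 ≤ A ^ 2 * (2 * d.α) ^ 2 / x ^ 2 := by
    rw [le_div_iff₀ (by positivity)]
    calc (x * A * (d.ξ₁ - y * d.ξ₂)) ^ 2 * x ^ 2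
        = A ^ 2 * ((x ^ 2 * x ^ 2) * (d.ξ₁ - y * d.ξ₂) ^ 2) := by ring
      _ ≤ A ^ 2 * (1 * (2 * d.α) ^ 2) := by gcongr
      _ = A ^ 2 * (2 * d.α) ^ 2 := by ring
  have h2 : d.E * (1 - y) ^ 2 / (x * A * (1 - y)) ^ 2 ≤ 4 * d.E / A ^ 2 / x ^ 2 := by
    have : 1 - y ≠ 0 := by linarith
    have : d.E * (1 - y) ^ 2 / (x * A * (1 - y)) ^ 2 = d.E / A ^ 2 / x ^ 2 := by field_simp
    rw [this]
    gcongr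
    linarith
  rw [add_div, add_div]
  exact add_le_add (add_le_add h1 h2) h3

/-- Dropping R² from F gives only E(1 - ε)²/G ≤ R². Keeping it leaves a surplus R⁴ ≥ (E(1 - ε)²/G)²,
which for small ε covers the missing Eε(1 - ε). -/
lemma bounds_of_F_le {k R V G B : ℝ} (hR : 0 < R) (hF : d.F k R V ≤ G) (hGB : G ≤ B)
    (hε : d.ε k ≤ 1 / 2) (hεB : d.ε k ≤ d.E / (8 * B ^ 2)) :
    R ^ 2 ≤ G ∧ V ^ 2 ≤ G ∧ d.E * (1 - d.ε k) / G ≤ R ^ 2 := by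
  have hE := d.E_pos
  have hε0 := d.ε_pos k
  rw [F] at hF
  set y := d.ε k
  have hy : 0 < 1 - y := by linarith
  have he : 0 < d.E * (1 - y) ^ 2 := by positivity
  have h0 : 0 < d.E * (1 - y) ^ 2 / R ^ 2 := by positivity
  have hR2 : 0 < R ^ 2 := by positivity
  have hV2 := sq_nonneg V
  have hG : 0 < G := by linarith
  have hB : 0 < B := hG.trans_le hGB
  refine ⟨by linarith, by linarith, ?_⟩
  rw [div_le_iff₀ hG]
  have h1 : d.E * (1 - y) ^ 2 + R ^ 2 * R ^ 2 ≤ R ^ 2 * G := by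
    have h2 : d.E * (1 - y) ^ 2 / R ^ 2 ≤ G - R ^ 2 := by linarith
    rw [div_le_iff₀ hR2] at h2
    linarith
  have h2 : d.E * (1 - y) ^ 2 / G ≤ R ^ 2 := by
    rw [div_le_iff₀ hG]
    nlinarith
  have h3 : (d.E * (1 - y) ^ 2 / G) ^ 2 ≤ R ^ 2 * R ^ 2 := by
    rw [← sq]; gcongr
  have h4 : d.E * y * (1 - y) ≤ (d.E * (1 - y) ^ 2 / G) ^ 2 := by
    rw [div_pow, le_div_iff₀ (by positivity)]
    rw [le_div_iff₀ (by positivity)] at hεB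
    have h5 : y * G ^ 2 ≤ d.E / 8 := by
      calc y * G ^ 2 ≤ y * B ^ 2 := by gcongr
        _ ≤ d.E / 8 := by linarith
    have h6 : (1 / 2) ^ 3 ≤ (1 - y) ^ 3 := by
      gcongr; linarith
    have h7 : y * G ^ 2 ≤ d.E * (1 - y) ^ 3 := by nlinarith
    calc d.E * y * (1 - y) * G ^ 2 = d.E * (1 - y) * (y * G ^ 2) := by ring
      _ ≤ d.E * (1 - y) * (d.E * (1 - y) ^ 3) := by gcongr
      _ = _ := by ring
  nlinarith

end Data

end CornerPenalty

end

/-! ### Uniform constants and conclusion. -/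

theorem mainTheorem8 (d : CornerPenalty.Data) (Rbar : ℝ) (hRbar : d.threshold < Rbar) :
    ∃ Rm RM VM : ℝ, 0 < Rm ∧ 0 < RM ∧ 0 < VM ∧
      ∀ ζ : ℝ, 0 < ζ → ζ < 1 / |d.ξ₁| →
        ∃ C k₀ : ℝ, 0 < C ∧ 0 < k₀ ∧ ∀ k : ℝ, k₀ ≤ k →
          (∃ R V : ℝ → ℝ, d.IsScaledMotion k R V) ∧
          ∀ R V : ℝ → ℝ, d.IsScaledMotion k R V →
            ∃ τ₄ : ℝ,
              IsLeast {τ : ℝ | d.τ₃ ζ k ≤ τ ∧ R τ = Rbar} τ₄ ∧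
              τ₄ ≤ d.τ₃ ζ k + 2 * d.lam₂ *
                (Real.log (d.quadForm (R (d.τ₃ ζ k)) (V (d.τ₃ ζ k)))
                  - Real.log (d.lam₁ * Rbar ^ 2)) ∧
              τ₄ ≤ d.τ₃ ζ k + C * Real.log (1 / d.η k) ∧
              d.ξ₁ * Rbar ≤ V τ₄ ∧ V τ₄ ≤ 0 ∧
              d.F k (R τ₄) (V τ₄) ≤ d.Fbar k Rbar ∧
              ∀ τ : ℝ, τ₄ ≤ τ →
                (Rm ≤ R τ ∧ R τ ≤ RM ∧ |V τ| ≤ VM) ∧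
                (d.E * (1 - d.ε k) / d.Fbar k Rbar ≤ R τ ^ 2 ∧
                  R τ ^ 2 ≤ d.Fbar k Rbar ∧ V τ ^ 2 ≤ d.Fbar k Rbar) := by
  obtain ⟨hR0, hthr⟩ := d.threshold_spec hRbar
  have hE := d.E_pos
  have hl₁ := d.lam₁_pos
  have hl₂ := d.lam₂_pos
  have hξ₁ := d.ξ₁_neg
  set B : ℝ := Rbar ^ 2 + d.E / Rbar ^ 2 + d.ξ₁ ^ 2 * Rbar ^ 2 with hB
  have hB0 : 0 < B := by positivity
  set A : ℝ := d.dr₀ / (2 * Real.sqrt d.Δ) with hA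
  have hA0 : 0 < A := div_pos d.dr₀_pos (mul_pos two_pos d.sqrt_Δ_pos)
  -- B bounds F̄ for every large k, since (1 - ε)² ≤ 1; the 2 comes from 1 - ε ≥ 1/2.
  refine ⟨Real.sqrt (d.E / (2 * B)), Real.sqrt B, Real.sqrt B, by positivity, by positivity,
    by positivity, fun ζ hζ hζ1 => ?_⟩
  have hζξ : 0 < 1 + d.ξ₁ * ζ := by
    rw [abs_of_neg hξ₁, lt_div_iff₀ (by linarith)] at hζ1
    linarith
  -- The 32 is 8 · 4, because (1 - ε)² ≥ 1/4.
  set c : ℝ := min 1 (d.E * Real.exp d.ξ₂ / 32) with hc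
  have hc0 : 0 < c := lt_min one_pos (by positivity)
  set C₁ : ℝ := A ^ 2 + 4 * d.E / A ^ 2 + A ^ 2 * (2 * d.α) ^ 2 with hC₁
  have hC₁0 : 0 < C₁ := by positivity
  set D : ℝ := Real.log (d.lam₂ * C₁) - Real.log (d.lam₁ * Rbar ^ 2) with hD
  have hL := d.tendsto_log_one_div_η
  have hgrow : Filter.Tendsto (fun k => Real.exp (2 * d.ξ₂) * (c / A) *
      Real.exp ((1 + d.ξ₁ * ζ) * Real.log (1 / d.η k))) Filter.atTop Filter.atTop :=
    (Real.tendsto_exp_atTop.comp (hL.const_mul_atTop hζξ)).const_mul_atTop (by positivity)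
  obtain ⟨k₁, hk₁⟩ := Filter.eventually_atTop.1 <|
    (hgrow.eventually_gt_atTop Rbar).and <| (hL.eventually_ge_atTop 1).and <|
    ((hL.const_mul_atTop hζ).eventually_ge_atTop 2).and <|
    (d.tendsto_η.eventually_le_const (show (0 : ℝ) < min 1 (1 / A) by positivity)).and
    (d.tendsto_ε.eventually_le_const
      (show (0 : ℝ) < min (1 / 2) (d.E / (8 * B ^ 2)) by positivity))
  -- The logarithmic difference is at most D + 2 ln(1/η), and ln(1/η) ≥ 1 absorbs D.
  refine ⟨2 * d.lam₂ * (|D| + 2), max k₁ 1, by positivity, by positivity, fun k hk => ?_⟩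
  have hk0 : 0 < k := one_pos.trans_le ((le_max_right _ _).trans hk)
  obtain ⟨hgr, hL1, hτ2, hη, hε⟩ := hk₁ k ((le_max_left _ _).trans hk)
  obtain ⟨hη1, hηA⟩ := le_min_iff.1 hη
  obtain ⟨hε2, hεB⟩ := le_min_iff.1 hε
  have hε0 := d.ε_pos k
  have hη0 := d.η_pos k
  refine ⟨d.exists_isScaledMotion hk0, fun R V h => ?_⟩
  have hτ3 : (2 : ℝ) ≤ d.τ₃ ζ k := hτ2
  have hτ30 : 0 ≤ d.τ₃ ζ k := by linarith
  have hy2 : (1 / 2) ^ 2 ≤ (1 - d.ε k) ^ 2 := pow_le_pow_left₀ (by norm_num) (by linarith) 2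
  have hy1 : (1 - d.ε k) ^ 2 ≤ 1 := pow_le_one₀ (by linarith) (by linarith)
  have hinit : d.initR k ≤ d.η k * A := by
    rw [d.initR_eq, ← hA]
    exact mul_le_of_le_one_right (by positivity) (by linarith)
  have hinit1 : d.initR k ≤ 1 := hinit.trans (by rwa [le_div_iff₀ hA0] at hηA)
  have hRτ : Rbar < R (d.τ₃ ζ k) := by
    refine hgr.trans_le (le_trans ?_ (h.exp_mul_le_R hk0 hinit1 hc0.le (min_le_left _ _)
      ((min_le_right _ _).trans ?_) hτ3))
    · have h1 : c / (d.η k * A) ≤ c / d.initR k :=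
        div_le_div_of_nonneg_left hc0.le (d.initR_pos hk0) hinit
      have h2 : Real.exp (2 * d.ξ₂) * (c / A) *
          Real.exp ((1 + d.ξ₁ * ζ) * Real.log (1 / d.η k))
          = Real.exp (d.ξ₁ * d.τ₃ ζ k) * (Real.exp (2 * d.ξ₂) * (c / (d.η k * A))) := by
        have h3 : Real.exp ((1 + d.ξ₁ * ζ) * Real.log (1 / d.η k))
            = 1 / d.η k * Real.exp (d.ξ₁ * d.τ₃ ζ k) := by
          rw [add_mul, one_mul, Real.exp_add, Real.exp_log (by positivity),
            CornerPenalty.Data.τ₃, mul_assoc]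
        rw [h3]
        field_simp
      rw [h2]
      gcongr
    · have := Real.exp_pos d.ξ₂
      have h1 : d.E * Real.exp d.ξ₂ * (1 / 2) ^ 2 ≤ d.E * Real.exp d.ξ₂ * (1 - d.ε k) ^ 2 := by
        gcongr
      linarith
  obtain ⟨τ₄, hleast, hbound, hV0⟩ := h.exists_first_hitting hk0 hR0 hthr hτ30 hRτ
  have hτ4 : 0 ≤ τ₄ := hτ30.trans hleast.1.1
  have hR4 : R τ₄ = Rbar := hleast.1.2
  have hV1 : d.ξ₁ * Rbar ≤ V τ₄ := by
    have := h.sub_pos hτ4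
    rw [hR4] at this
    linarith
  have hF4 : d.F k (R τ₄) (V τ₄) ≤ d.Fbar k Rbar := by
    have hV2 : (-V τ₄) ^ 2 ≤ (-(d.ξ₁ * Rbar)) ^ 2 :=
      pow_le_pow_left₀ (by linarith) (by linarith) 2
    rw [neg_sq, neg_sq, mul_pow] at hV2
    rw [CornerPenalty.Data.F, CornerPenalty.Data.Fbar, hR4]
    linarith
  have hFB : d.Fbar k Rbar ≤ B := by
    rw [CornerPenalty.Data.Fbar, hB]
    gcongr
    exact mul_le_of_le_one_right hE.le hy1
  refine ⟨τ₄, hleast, hbound, ?_, hV1, hV0, hF4, fun τ hτ => ?_⟩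
  · set x := R (d.τ₃ ζ k)
    set v := V (d.τ₃ ζ k)
    have hx : 0 < x := hR0.trans hRτ
    have h1 : x ^ 2 + v ^ 2 ≤ C₁ / d.η k ^ 2 := by
      have h2 := h.F_antitone le_rfl hτ30
      rw [h.init_R, h.init_V] at h2
      replace h2 : d.F k x v ≤ C₁ / d.η k ^ 2 := h2.trans (d.F_init_le hη1 hε2 hA)
      have h3 : 0 ≤ d.E * (1 - d.ε k) ^ 2 / x ^ 2 := by positivity
      have h4 : d.F k x v = x ^ 2 + d.E * (1 - d.ε k) ^ 2 / x ^ 2 + v ^ 2 := rfl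
      linarith
    have hq0 : 0 < d.quadForm x v :=
      lt_of_lt_of_le (by positivity) (d.lam₁_mul_le_quadForm x v)
    have hq1 : d.quadForm x v ≤ d.lam₂ * C₁ * (1 / d.η k) ^ 2 := by
      calc d.quadForm x v ≤ d.lam₂ * (x ^ 2 + v ^ 2) := d.quadForm_le_lam₂_mul x v
        _ ≤ d.lam₂ * (C₁ / d.η k ^ 2) := by gcongr
        _ = _ := by field_simp
    have h2 := Real.log_le_log hq0 hq1
    rw [Real.log_mul (by positivity) (by positivity), Real.log_pow] at h2
    push_cast at h2
    have h3 : Real.log (d.quadForm x v) - Real.log (d.lam₁ * Rbar ^ 2)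
        ≤ (|D| + 2) * Real.log (1 / d.η k) := by
      have h4 := le_abs_self D
      have h5 : |D| ≤ |D| * Real.log (1 / d.η k) := le_mul_of_one_le_right (abs_nonneg D) hL1
      linarith
    have h4 := mul_le_mul_of_nonneg_left h3 (show 0 ≤ 2 * d.lam₂ by positivity)
    linarith
  · have hRp := h.pos τ (hτ4.trans hτ)
    obtain ⟨hb1, hb2, hb3⟩ := d.bounds_of_F_le hRp ((h.F_antitone hτ4 hτ).trans hF4) hFB hε2 hεB
    have hG : 0 < d.Fbar k Rbar := lt_of_lt_of_le (by positivity) hb1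
    refine ⟨⟨Real.sqrt_le_iff.2 ⟨hRp.le, le_trans ?_ hb3⟩,
      Real.le_sqrt_of_sq_le (hb1.trans hFB), Real.le_sqrt_of_sq_le ?_⟩, hb3, hb1, hb2⟩
    · rw [show d.E / (2 * B) = d.E * (1 / 2) / B by field_simp]
      have h1 : d.E * (1 / 2) ≤ d.E * (1 - d.ε k) :=
        mul_le_mul_of_nonneg_left (by linarith) hE.le
      exact div_le_div₀ (by linarith) h1 hG hFB
    · rw [sq_abs]
      exact hb2.trans hFB
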